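/- **Automata.** All parity conditions are min-parity on transitions: a sequence of priorities is accepting if the least priority occurring infinitely often is even. A parity automaton has transitions $(q,a,c,q')$ with letter $a$ and priority $c$; its language $L(\cdot)$ is the set of infinite words having an accepting run from an initial state. An $\varepsilon$-automaton over $\Gamma$ is a parity automaton over $\Gamma\uplus\{\varepsilon\}$; its language is the set of $w\in\Gamma^\omega$ obtained by erasing all $\varepsilon$'s from some accepted $w'\in(\Gamma\uplus\{\varepsilon\})^\omega$. Write $p\xrightarrow{\varepsilon:c}q$ if $(p,\varepsilon,c,q)$ is a transition. An $\varepsilon$-automaton is *$\varepsilon$-complete* with index $\{0,\dots,2d+1\}$ if all its priorities lie in this index and: (1) $\xrightarrow{\varepsilon:1},\xrightarrow{\varepsilon:3},\dots,\xrightarrow{\varepsilon:2d+1}$ are total preorders, each refining (contained in) the previous one; (2) for all $0\le i\le d$ and all $p,q$: $p\xrightarrow{\varepsilon:2i}q$ if and only if not $q\xrightarrow{\varepsilon:2i+1}p$. **Ordered Büchi automata.** Let $Q$ be a finite totally ordered set with $n=|Q|\ge 1$ elements. On $Q\times\{0,1\}\times Q$ let $(p,c,q)\preceq(p',c',q')$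 mean: $p\le p'$, $q'\le q$, and $c\le c'$ if $(p,q)=(p',q')$. An ordered Büchi automaton $\mathcal A=(Q,\le,I,\Gamma)$ consists of a downward closed $I\subseteq Q$ and a set $\Gamma$ of $\preceq$-upward closed subsets ("tiles") $t\subseteq Q\times\{0,1\}\times Q$. Write $p\xrightarrow{t:c}q$ for $(p,c,q)\in t$ and $p\xrightarrow{t}q$ if this holds for some $c$; $t(X)=\{q\mid\exists p\in X,\ p\xrightarrow{t}q\}$; and $\delta_t(p)=\max\{q\mid p\xrightarrow{t}q\}$, or $\bot$ if there is no such $q$. **Determinization.** A *record* is a (possibly empty) tuple $s=(s(0),\dots,s(k-1))$ of pairwise distinct states whose image is downward closed and whose first entry, if any, is its maximum. The automaton $\mathcal A_D$ has alphabet $\Gamma$, all records as states, and as only initial state the record listing $I$ in decreasing order. For a record $s$ of length $k$ and $t\in\Gamma$ it has exactly one transition $(s,t,c,s')$, defined as follows. Let $\mathrm{best}(i)=\delta_t(s(i))$ for $i<k$, let $P$ be the set of $i<k$ with $\mathrm{best}(i)\ne\bot$ and $\mathrm{best}(j)\neq\mathrm{best}(i)$ for all $j<i$, and let $R=t(\mathrm{img}\,s)\setminus\mathrm{best}(P)$.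 Then $s'$ lists first $\mathrm{best}(i)$ for $i\in P$, in increasing order of $i$, and then the elements of $R$ in decreasing order. Moreover $c=\min(2g,2r-1)$ with $g=\min\{i\mid s(i)\xrightarrow{t:0}s'(i)\}$ and $r=\min(\{0,\dots,k-1\}\setminus P)$, where the minimum of the empty set is $|t(\mathrm{img}\,s)|$. For $0\le i<n$ let $\le^i_{\mathrm{lex}}$ be the lexicographic preorder on records given by their first $i+1$ entries (missing entries being filled with $\bot$, smaller than every state), and $<^i_{\mathrm{lex}}$ its strict variant. Let $$\Delta_\varepsilon=\bigcup_{0\le i<n}\Big(\{(s,\varepsilon,2i,s')\mid s'<^i_{\mathrm{lex}}s\}\cup\{(s',\varepsilon,2i+1,s)\mid s\le^i_{\mathrm{lex}}s'\}\Big).$$ **Lemma.** For every ordered Büchi automaton $\mathcal A$ as above, adding $\Delta_\varepsilon$ to $\mathcal A_D$ makes it $\varepsilon$-complete without changing its language. Precisely, all priorities of $\mathcal A_D$ lie in $\{-1,\dots,2n-1\}$, the $\varepsilon$-automaton $\mathcal A_D\cup\Delta_\varepsilon$ satisfies (1) and (2) with $d=n-1$, and $L(\mathcal A_D\cup\Delta_\varepsilon)=L(\mathcal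 A_D)$. Moreover, if $\mathcal A_D'$ denotes $\mathcal A_D$ with priority $-1$ replaced by $1$, then $\mathcal A_D'\cup\Delta_\varepsilon$ is $\varepsilon$-complete with index $\{0,\dots,2n-1\}$, and $L(\mathcal A_D'\cup\Delta_\varepsilon)=L(\mathcal A_D)$. All of these assertions about $\mathcal A_D\cup\Delta_\varepsilon$ and $\mathcal A_D'\cup\Delta_\varepsilon$ remain true, with the same $n$ and the same language $L(\mathcal A_D)$, if these automata are restricted to any set of records that contains all the records accessible in $\mathcal A_D$ (in particular, to the accessible ones). -/

import Mathlib

namespace OrderedBuchi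

/-! ### Parity automata (min-parity condition, transition based) -/

/-- A sequence of priorities is parity accepting when its inferior limit (the least value that
occurs infinitely often) exists and is even. -/
def ParityAccepting (c : ℕ → ℤ) : Prop :=
  ∃ m : ℤ, Even m ∧ (∀ᶠ k in Filter.atTop, m ≤ c k) ∧ (∃ᶠ k in Filter.atTop, c k = m)

/-- A non-deterministic parity automaton; `(q, a, c, q') ∈ trans` is a transition from `q` to `q'`
over the letter `a` with priority `c`. -/
structure ParityAutomaton (Letter State : Type*) where
  init : Set State
  trans : Set (State × Letter × ℤ × State)

namespace ParityAutomaton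

variable {Letter State : Type*}

/-- All priorities belong to the index `[lo, hi]`. -/
def HasIndex (A : ParityAutomaton Letter State) (lo hi : ℤ) : Prop :=
  ∀ q a c q', (q, a, c, q') ∈ A.trans → c ∈ Set.Icc lo hi

/-- The language: the infinite words with an accepting run. -/
def language (A : ParityAutomaton Letter State) : Set (ℕ → Letter) :=
  {w | ∃ (q : ℕ → State) (c : ℕ → ℤ), q 0 ∈ A.init ∧
    (∀ k, (q k, w k, c k, q (k + 1)) ∈ A.trans) ∧ ParityAccepting c}

/-- The states accessible from the initial states. -/
inductive Accessible (A : ParityAutomaton Letter State) : State → Prop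
  | init (q : State) (h : q ∈ A.init) : Accessible A q
  | step (q : State) (a : Letter) (c : ℤ) (q' : State) (hq : Accessible A q)
      (h : (q, a, c, q') ∈ A.trans) : Accessible A q'

/-- The automaton restricted to a set of states. -/
def restrict (A : ParityAutomaton Letter State) (X : Set State) : ParityAutomaton Letter X where
  init := {q | (q : State) ∈ A.init}
  trans := {δ | ((δ.1 : State), δ.2.1, δ.2.2.1, (δ.2.2.2 : State)) ∈ A.trans}

/-- Replace the priority `-1` by the priority `1`. -/
def normalize (A : ParityAutomaton Letter State) : ParityAutomaton Letter State where
  init := A.init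
  trans := {δ | ∃ c : ℤ, (δ.1, δ.2.1, c, δ.2.2.2) ∈ A.trans ∧
    δ.2.2.1 = if c = -1 then 1 else c}

/-- Add a set `E` of `ε`-transitions. An `ε`-automaton over `Letter` is an automaton over
`Option Letter`, where `none` is the letter `ε`. -/
def addEps (A : ParityAutomaton Letter State) (E : Set (State × ℤ × State)) :
    ParityAutomaton (Option Letter) State where
  init := A.init
  trans := {δ | (∃ a, δ.2.1 = some a ∧ (δ.1, a, δ.2.2) ∈ A.trans) ∨ (δ.2.1 = none ∧ (δ.1, δ.2.2) ∈ E)}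

/-- `w` is obtained from `w'` by removing all the occurrences of `ε`. -/
def IsEpsErasure (w' : ℕ → Option Letter) (w : ℕ → Letter) : Prop :=
  ∃ g : ℕ → ℕ, StrictMono g ∧ (∀ j, w' (g j) = some (w j)) ∧ ∀ m, w' m ≠ none → m ∈ Set.range g

/-- The language over `Letter` of an `ε`-automaton. -/
def epsLanguage (A : ParityAutomaton (Option Letter) State) : Set (ℕ → Letter) :=
  {w | ∃ w' ∈ A.language, IsEpsErasure w' w}

/-- `q →[ε : c] q'`. -/
def EpsRel (A : ParityAutomaton (Option Letter) State) (c : ℤ) (q q' : State) : Prop :=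
  (q, none, c, q') ∈ A.trans

/-- The two conditions on `ε`-transitions in the definition of `ε`-completeness, for the priorities
`0, 1, …, 2 d + 1`. -/
structure EpsPreorders (A : ParityAutomaton (Option Letter) State) (d : ℕ) : Prop where
  trans_odd : ∀ i : ℕ, i ≤ d → ∀ p q r, A.EpsRel (2 * i + 1) p q → A.EpsRel (2 * i + 1) q r →
    A.EpsRel (2 * i + 1) p r
  total_odd : ∀ i : ℕ, i ≤ d → ∀ p q, A.EpsRel (2 * i + 1) p q ∨ A.EpsRel (2 * i + 1) q p
  refines : ∀ i : ℕ, i + 1 ≤ d → ∀ p q, A.EpsRel (2 * (i + 1) + 1) p q → A.EpsRel (2 * i + 1) p q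
  even_iff : ∀ i : ℕ, i ≤ d → ∀ p q, A.EpsRel (2 * i) p q ↔ ¬ A.EpsRel (2 * i + 1) q p

/-- `A` is `ε`-complete, with index `{0, 1, …, 2 d + 1}`. -/
def IsEpsComplete (A : ParityAutomaton (Option Letter) State) (d : ℕ) : Prop :=
  A.HasIndex 0 (2 * d + 1) ∧ A.EpsPreorders d

end ParityAutomaton

/-! ### Ordered Büchi automata -/

section

variable {Q : Type*} [LinearOrder Q]

/-- The order on Büchi transitions. -/
def TransLE (δ δ' : Q × Fin 2 × Q) : Prop :=
  δ.1 ≤ δ'.1 ∧ δ'.2.2 ≤ δ.2.2 ∧ (δ.1 = δ'.1 → δ.2.2 = δ'.2.2 → δ.2.1 ≤ δ'.2.1)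

variable (Q) in
/-- Büchi tiles that are upward closed for `TransLE`. -/
structure UpTile where
  carrier : Set (Q × Fin 2 × Q)
  up : ∀ δ δ', TransLE δ δ' → δ ∈ carrier → δ' ∈ carrier

variable (Q) in
/-- Ordered Büchi automata with the totally ordered set `Q` of states, as tile automata. -/
structure OrderedBuchiAutomaton where
  init : Set Q
  init_lower : IsLowerSet init
  tiles : Set (UpTile Q)

/-- `p →[t] q`, for some priority. -/
def UpTile.Rel (t : UpTile Q) (p q : Q) : Prop := ∃ c, (p, c, q) ∈ t.carrier

theorem rel_of_le {t : UpTile Q} {p q p' q' : Q} (h : t.Rel p q) (hp : p ≤ p') (hq : q' ≤ q) :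
    t.Rel p' q' := by
  obtain ⟨c, hc⟩ := h
  exact ⟨c, t.up (p, c, q) (p', c, q') ⟨hp, hq, fun _ _ => le_refl _⟩ hc⟩

variable (Q) in
/-- Records (the empty record included), as lists of states. -/
@[ext] structure Record where
  toList : List Q
  nodup : toList.Nodup
  lower : IsLowerSet {q | q ∈ toList}
  head_max : ∀ q ∈ toList.head?, ∀ p ∈ toList, p ≤ q

/-- The entry of index `i` of a record, or `⊥` when `i` is not in its domain. -/
def Record.entry (s : Record Q) (i : ℕ) : WithBot Q := (s.toList[i]?).elim ⊥ (fun q => (q : WithBot Q))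

/-- The entries of indices `0, …, i` of a record, in the lexicographically ordered set of tuples. -/
def Record.pre (s : Record Q) (i : ℕ) : Lex (Fin (i + 1) → WithBot Q) :=
  toLex fun j => s.entry j

/-! ### Determinization -/

variable [Fintype Q]

open Classical in
/-- The greatest `q'` with `q →[t] q'`, or `none` (that is, `⊥`) if there is none. -/
noncomputable def UpTile.ska (t : UpTile Q) (q : Q) : Option Q :=
  if h : (Finset.univ.filter fun q' => t.Rel q q').Nonempty then some (Finset.max' _ h) else none

namespace Record

/-- `best i = ska (s i)`, and `none` when `i` is not in the domain of `s`. -/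
noncomputable def best (s : Record Q) (t : UpTile Q) (i : ℕ) : Option Q := (s.toList[i]?).bind t.ska

/-- The least index with the same `best` as `i`. -/
noncomputable def leader (s : Record Q) (t : UpTile Q) (i : ℕ) : ℕ :=
  sInf {j | j < s.toList.length ∧ s.best t j = s.best t i}

open Classical in
/-- The set `P` of leaders, among the indices whose path can be extended (`best i ≠ ⊥`). -/
noncomputable def leaders (s : Record Q) (t : UpTile Q) : Finset ℕ :=
  ((Finset.range s.toList.length).filter fun i => s.best t i ≠ none).image (s.leader t)

open Classical in
/-- `t (img s)`. -/
noncomputable def succStates (s : Record Q) (t : UpTile Q) : Finset Q :=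
  Finset.univ.filter fun q' => ∃ q ∈ s.toList, t.Rel q q'

open Classical in
/-- The set `R` of reset states: `t (img s) \ best P`. -/
noncomputable def resets (s : Record Q) (t : UpTile Q) : Finset Q :=
  (s.succStates t).filter fun q' => ∀ i ∈ s.leaders t, s.best t i ≠ some q'

/-- The entries of the next record: the `best i` for `i ∈ P` in increasing order of the indices,
followed by the states of `R` in decreasing order. -/
noncomputable def nextList (s : Record Q) (t : UpTile Q) : List Q :=
  ((s.leaders t).sort (· ≤ ·)).filterMap (s.best t) ++ (s.resets t).sort (· ≥ ·)

theorem ska_eq_some {t : UpTile Q} {q r : Q} (h : t.ska q = some r) :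
    t.Rel q r ∧ ∀ r', t.Rel q r' → r' ≤ r := by
  classical
  unfold UpTile.ska at h
  split_ifs at h with hn
  have h' := Option.some.inj h
  have hm := Finset.max'_mem _ hn
  rw [h'] at hm
  refine ⟨by simpa using hm, fun r' hr' => ?_⟩
  rw [← h']
  exact Finset.le_max' _ _ (by simpa using hr')

theorem ska_exists {t : UpTile Q} {q r : Q} (h : t.Rel q r) : ∃ r', t.ska q = some r' := by
  classical
  unfold UpTile.ska
  rw [dif_pos ⟨r, by simpa using h⟩]
  exact ⟨_, rfl⟩

theorem best_eq_some {s : Record Q} {t : UpTile Q} {i : ℕ} {r : Q} (h : s.best t i = some r) :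
    ∃ q, s.toList[i]? = some q ∧ t.ska q = some r := by
  simpa [best, Option.bind_eq_some_iff] using h

theorem mem_leaders {s : Record Q} {t : UpTile Q} {i : ℕ} :
    i ∈ s.leaders t ↔ i < s.toList.length ∧ s.best t i ≠ none ∧
      ∀ j < i, s.best t j ≠ s.best t i := by
  classical
  simp only [leaders, Finset.mem_image, Finset.mem_filter, Finset.mem_range]
  constructor
  · rintro ⟨k, ⟨hk, hb⟩, rfl⟩
    have hne : {j | j < s.toList.length ∧ s.best t j = s.best t k}.Nonempty := ⟨k, hk, rfl⟩
    obtain ⟨h1, h2⟩ := Nat.sInf_mem hne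
    change s.leader t k < _ at h1
    change s.best t (s.leader t k) = _ at h2
    refine ⟨h1, by rwa [h2], fun j hj he => ?_⟩
    exact Nat.notMem_of_lt_sInf hj ⟨hj.trans h1, he.trans h2⟩
  · rintro ⟨h1, h2, h3⟩
    refine ⟨i, ⟨h1, h2⟩, ?_⟩
    have hne : {j | j < s.toList.length ∧ s.best t j = s.best t i}.Nonempty := ⟨i, h1, rfl⟩
    obtain ⟨_, h5⟩ := Nat.sInf_mem hne
    refine le_antisymm (Nat.sInf_le ⟨h1, rfl⟩) ?_
    by_contra hlt
    exact h3 _ (not_le.1 hlt) h5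

theorem mem_nextList {s : Record Q} {t : UpTile Q} {r : Q} :
    r ∈ s.nextList t ↔ ∃ q ∈ s.toList, t.Rel q r := by
  classical
  simp only [nextList, List.mem_append, List.mem_filterMap, Finset.mem_sort, resets,
    Finset.mem_filter, succStates, Finset.mem_univ, true_and]
  constructor
  · rintro (⟨i, _, hi⟩ | ⟨h, _⟩)
    · obtain ⟨q, hq, hr⟩ := best_eq_some hi
      exact ⟨q, List.mem_of_getElem? hq, (ska_eq_some hr).1⟩
    · exact h
  · intro h
    by_cases hc : ∃ i ∈ s.leaders t, s.best t i = some r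
    · exact Or.inl hc
    · push Not at hc
      exact Or.inr ⟨h, hc⟩

theorem nextList_nodup (s : Record Q) (t : UpTile Q) : (s.nextList t).Nodup := by
  classical
  refine List.Nodup.append ?_ (Finset.sort_nodup _ _) ?_
  · have hnd : ((s.leaders t).sort (· ≤ ·)).Nodup := Finset.sort_nodup _ _
    have hmem : ∀ i ∈ (s.leaders t).sort (· ≤ ·), i ∈ s.leaders t := fun i hi => by simpa using hi
    generalize (s.leaders t).sort (· ≤ ·) = l at hnd hmem
    refine List.Pairwise.filterMap _ ?_ (List.Pairwise.and_mem.1 hnd)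
    rintro i j ⟨hi, hj, hij⟩ b hb b' hb' rfl
    have h1 := mem_leaders.1 (hmem i hi)
    have h2 := mem_leaders.1 (hmem j hj)
    rcases lt_or_gt_of_ne hij with h | h
    · exact h2.2.2 i h (hb.trans hb'.symm)
    · exact h1.2.2 j h (hb'.trans hb.symm)
  · intro r h1 h2
    simp only [List.mem_filterMap, Finset.mem_sort, resets, Finset.mem_filter] at h1 h2
    obtain ⟨i, hi, hr⟩ := h1
    exact h2.2 i hi hr

theorem nextList_head (s : Record Q) (t : UpTile Q) :
    ∀ q ∈ (s.nextList t).head?, ∀ p ∈ s.nextList t, p ≤ q := by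
  classical
  intro q hq p hp
  obtain ⟨x, hx, hxp⟩ := mem_nextList.1 hp
  have hpos : 0 < s.toList.length := List.length_pos_of_mem hx
  have h0 : s.toList[0]? = some s.toList[0] := List.getElem?_eq_getElem hpos
  have hmax : ∀ y ∈ s.toList, y ≤ s.toList[0] :=
    s.head_max _ (by rw [List.head?_eq_getElem?, h0]; rfl)
  have hrel : t.Rel s.toList[0] p := rel_of_le hxp (hmax x hx) le_rfl
  obtain ⟨m, hm⟩ := ska_exists hrel
  have hb : s.best t 0 = some m := by simp [best, h0, hm]
  have hmem : 0 ∈ s.leaders t :=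
    mem_leaders.2 ⟨hpos, by simp [hb], fun j hj => absurd hj (Nat.not_lt_zero j)⟩
  have hsort : ∃ l, (s.leaders t).sort (· ≤ ·) = 0 :: l := by
    have hs : ((s.leaders t).sort (· ≤ ·)).Pairwise (· ≤ ·) := Finset.pairwise_sort _ _
    have hz : 0 ∈ (s.leaders t).sort (· ≤ ·) := by simpa using hmem
    generalize (s.leaders t).sort (· ≤ ·) = l at hs hz
    cases l with
    | nil => simp at hz
    | cons a l =>
      rcases List.mem_cons.1 hz with h | h
      · exact ⟨l, by rw [h]⟩
      · have := (List.pairwise_cons.1 hs).1 0 h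
        exact ⟨l, by rw [Nat.le_zero.1 this]⟩
  obtain ⟨l, hl⟩ := hsort
  have hhead : (s.nextList t).head? = some m := by
    simp [nextList, hl, hb]
  rw [hhead] at hq
  have : m = q := by simpa using hq
  rw [← this]
  exact (ska_eq_some hm).2 p hrel

/-- The next record. -/
noncomputable def next (s : Record Q) (t : UpTile Q) : Record Q where
  toList := s.nextList t
  nodup := nextList_nodup s t
  lower := by
    intro a b hba ha
    obtain ⟨q, hq, hr⟩ := mem_nextList.1 ha
    exact mem_nextList.2 ⟨q, hq, rel_of_le hr le_rfl hba⟩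
  head_max := nextList_head s t

/-- The minimum of a set of indices, which is `m` by convention if the set is empty. -/
def minOr (m : ℕ) (X : Finset ℕ) : ℕ := if h : X.Nonempty then X.min' h else m

open Classical in
/-- The least index that witnesses a Büchi transition. -/
noncomputable def green (s : Record Q) (t : UpTile Q) : ℕ :=
  minOr (s.succStates t).card ((Finset.range s.toList.length).filter fun i =>
    ∃ q q', s.toList[i]? = some q ∧ (s.next t).toList[i]? = some q' ∧ (q, 0, q') ∈ t.carrier)

/-- The least forgotten index. -/
noncomputable def red (s : Record Q) (t : UpTile Q) : ℕ :=
  minOr (s.succStates t).card (Finset.range s.toList.length \ s.leaders t)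

/-- The priority of the transition from `s` over `t`. -/
noncomputable def prio (s : Record Q) (t : UpTile Q) : ℤ :=
  min (2 * (s.green t : ℤ)) (2 * (s.red t : ℤ) - 1)

end Record

namespace OrderedBuchiAutomaton

open Classical in
/-- The initial record: the initial states in decreasing order. -/
noncomputable def initRecord (B : OrderedBuchiAutomaton Q) : Record Q where
  toList := (Finset.univ.filter fun q => q ∈ B.init).sort (· ≥ ·)
  nodup := Finset.sort_nodup _ _
  lower := by
    intro a b hba ha
    have ha' : a ∈ B.init := by simpa using ha
    simpa using B.init_lower hba ha'
  head_max := by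
    have hs : ((Finset.univ.filter fun q => q ∈ B.init).sort (· ≥ ·)).Pairwise (· ≥ ·) :=
      Finset.pairwise_sort _ _
    generalize (Finset.univ.filter fun q => q ∈ B.init).sort (· ≥ ·) = l at hs
    intro q hq p hp
    cases l with
    | nil => simp at hp
    | cons a l =>
      have hqa : a = q := by simpa using hq
      subst hqa
      rcases List.mem_cons.1 hp with h | h
      · exact h.le
      · exact (List.pairwise_cons.1 hs).1 p h

/-- The deterministic parity automaton obtained by determinization; its letters are the tiles of
`B`, and its transitions form the graph of the function `(s, t) ↦ (s.prio t, s.next t)`. -/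
noncomputable def det (B : OrderedBuchiAutomaton Q) : ParityAutomaton B.tiles (Record Q) where
  init := {B.initRecord}
  trans := {δ | δ.2.2 = (δ.1.prio δ.2.1.1, δ.1.next δ.2.1.1)}

end OrderedBuchiAutomaton

variable (Q) in
/-- The set of `ε`-transitions to be added. -/
def epsTransitions : Set (Record Q × ℤ × Record Q) :=
  {δ | ∃ (i : ℕ) (s s' : Record Q), i < Fintype.card Q ∧
    ((s'.pre i < s.pre i ∧ δ = (s, 2 * (i : ℤ), s')) ∨
      (s.pre i ≤ s'.pre i ∧ δ = (s', 2 * (i : ℤ) + 1, s)))}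

end

end OrderedBuchi

/-!
An `ε`-transition of priority at least `2 e` only decreases the first `e + 1` entries of a record
lexicographically. So let `2 e` be the least recurring priority of an accepting run with `ε`, and
let `j` be the least index below `e` whose entry is changed infinitely often by `ε`, or `e` if there
is none. From some time on, the entry of index `j` is then a path of the Büchi automaton that takes
infinitely many Büchi transitions, once `ε` is read as the tile that stays in place, or strictly
goes down by a Büchi transition. The tiles being upward closed, this path survives when every block
of `ε` is merged into the letter before it; and as `ε` never adds states to a record, its states
belong to the records of the run of the deterministic automaton over the word without `ε`.

It remains to see that a deterministic run is accepting as soon as its records contain a path with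
infinitely many Büchi transitions. Suppose that its least recurring priority is `2 r - 1`. The
entries of index less than `r` are eventually never forgotten and take no Büchi transition along
themselves, so that each of them ends up strictly above or strictly below the path. Consider the
least index of an entry that lies at or above the path and strictly below each of the former entries
that end up above it. It is eventually at least `r`, cannot increase, and drops whenever the index
`r` is forgotten; so this happens only finitely often, a contradiction.

The priority `-1` occurs exactly on the transitions into the empty record. Accepting runs avoid
that record, since no transition leads from it to another one and all the transitions on it have odd
priorities, so that replacing `-1` by `1` changes nothing.
-/

namespace OrderedBuchi

open Filter

section Sequences

theorem eventually_of_frequently_of_step {P : ℕ → Prop} (hf : ∃ᶠ k in atTop, P k)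
    (hstep : ∀ᶠ k in atTop, P k → P (k + 1)) : ∀ᶠ k in atTop, P k := by
  obtain ⟨K, hK⟩ := eventually_atTop.1 hstep
  obtain ⟨k, hk, hP⟩ := frequently_atTop.1 hf K
  refine eventually_atTop.2 ⟨k, fun b hb => ?_⟩
  induction b, hb using Nat.le_induction with
  | base => exact hP
  | succ b hb ih => exact hK b (hk.trans hb) ih

theorem forall_of_frequently_of_step_back {P : ℕ → Prop} (hf : ∃ᶠ k in atTop, P k)
    (hstep : ∀ k, P (k + 1) → P k) (k : ℕ) : P k := by
  obtain ⟨m, hm, hP⟩ := frequently_atTop.1 hf k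
  exact antitone_nat_of_succ_le (f := P) hstep hm hP

theorem eventually_succ_eq_of_eventually_succ_le {α : Type*} [PartialOrder α] [WellFoundedLT α]
    {f : ℕ → α} (h : ∀ᶠ k in atTop, f (k + 1) ≤ f k) : ∀ᶠ k in atTop, f (k + 1) = f k := by
  obtain ⟨K, hK⟩ := eventually_atTop.1 h
  have hanti : Antitone fun k => f (K + k) := antitone_nat_of_succ_le fun k => hK _ (by lia)
  obtain ⟨n, hn⟩ := WellFoundedLT.antitone_chain_condition hanti
  refine eventually_atTop.2 ⟨K + n, fun k hk => ?_⟩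
  obtain ⟨l, rfl⟩ := Nat.exists_eq_add_of_le hk
  simpa only [add_assoc] using (hn (n + l + 1) (by lia)).symm.trans (hn (n + l) (by lia))

theorem exists_eventually_le_and_frequently_eq {c : ℕ → ℤ} {lo hi : ℤ}
    (h : ∀ k, c k ∈ Set.Icc lo hi) :
    ∃ m, (∀ᶠ k in atTop, m ≤ c k) ∧ ∃ᶠ k in atTop, c k = m := by
  obtain ⟨m, hm, hmax⟩ := Int.exists_greatest_of_bdd (P := fun m => ∀ᶠ k in atTop, m ≤ c k)
    ⟨hi, fun z hz => hz.exists.elim fun k hk => hk.trans (h k).2⟩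
    ⟨lo, .of_forall fun k => (h k).1⟩
  refine ⟨m, hm, fun hne => (lt_add_one m).not_ge (hmax _ ?_)⟩
  filter_upwards [hm, hne] with k hle hne using hle.lt_of_ne' hne

theorem ParityAccepting.congr {c c' : ℕ → ℤ} (hc : ParityAccepting c)
    (h : ∀ᶠ k in atTop, c k = c' k) : ParityAccepting c' := by
  obtain ⟨m, hm, hle, heq⟩ := hc
  exact ⟨m, hm, by filter_upwards [hle, h] with k h₁ h₂ using h₂ ▸ h₁,
    (heq.and_eventually h).mono fun k hk => hk.2 ▸ hk.1⟩

variable {g : ℕ → ℕ}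

theorem exists_mem_Ico_of_strictMono (hg : StrictMono g) {K m : ℕ} (hm : g K ≤ m) :
    ∃ k ≥ K, m ∈ Set.Ico (g k) (g (k + 1)) := by
  have hunbounded : ¬ BddAbove (g '' Set.Ici K) := by
    rintro ⟨b, hb⟩
    have hle : g (K + b + 1) ≤ b := hb ⟨K + b + 1, Set.mem_Ici.2 (by lia), rfl⟩
    have := hg.le_apply (x := K + b + 1)
    lia
  simpa only [Set.mem_iUnion, Set.mem_Ici, exists_prop, Order.succ_eq_add_one] using
    (biUnion_Ici_Ico_map_succ (fun _ hi => hg.monotone hi) hunbounded).ge hm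

theorem notMem_range_of_mem_Ioo (hg : StrictMono g) {k m : ℕ}
    (hm : m ∈ Set.Ioo (g k) (g (k + 1))) : m ∉ Set.range g := by
  rintro ⟨l, rfl⟩
  have := hg.lt_iff_lt.1 hm.1
  have := hg.lt_iff_lt.1 hm.2
  lia

open Classical in
theorem count_mem_range_of_strictMono (hg : StrictMono g) (k : ℕ) :
    Nat.count (· ∈ Set.range g) (g k) = k := by
  have himage : (Finset.range (g k)).filter (· ∈ Set.range g) = (Finset.range k).image g := by
    ext m
    simp only [Finset.mem_filter, Finset.mem_range, Set.mem_range, Finset.mem_image]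
    exact ⟨fun ⟨hm, l, hl⟩ => ⟨l, hg.lt_iff_lt.1 (hl ▸ hm), hl⟩,
      fun ⟨l, hl, hm⟩ => ⟨hm ▸ hg hl, l, hm⟩⟩
  rw [Nat.count_eq_card_filter_range, himage, Finset.card_image_of_injective _ hg.injective,
    Finset.card_range]

end Sequences

section Tiles

variable {Q : Type*} [LinearOrder Q]

namespace UpTile

theorem mem_of_le {t : UpTile Q} {p q p' q' : Q} {c : Fin 2} (h : (p, c, q) ∈ t.carrier)
    (hp : p ≤ p') (hq : q' ≤ q) : (p', c, q') ∈ t.carrier :=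
  t.up (p, c, q) (p', c, q') ⟨hp, hq, fun _ _ => le_rfl⟩ h

theorem mem_of_lt_left {t : UpTile Q} {p p' q : Q} (h : t.Rel p q) (hp : p < p') (c : Fin 2) :
    (p', c, q) ∈ t.carrier :=
  let ⟨c', hc'⟩ := h
  t.up (p, c', q) (p', c, q) ⟨hp.le, le_rfl, fun e => absurd e hp.ne⟩ hc'

theorem mem_of_lt_right {t : UpTile Q} {p q q' : Q} (h : t.Rel p q) (hq : q' < q) (c : Fin 2) :
    (p, c, q') ∈ t.carrier :=
  let ⟨c', hc'⟩ := h
  t.up (p, c', q) (p, c, q') ⟨le_rfl, hq.le, fun _ e => absurd e hq.ne'⟩ hc'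

variable (Q) in
/-- The neutral tile, by which `ε` acts on the paths of an ordered Büchi automaton: staying in
place is not a Büchi transition, while going down strictly is one. -/
def eps : UpTile Q where
  carrier := {δ | δ.2.2 < δ.1 ∨ δ.2.2 = δ.1 ∧ δ.2.1 = 1}
  up := by
    rintro ⟨p, c, q⟩ ⟨p', c', q'⟩ ⟨hp, hq, hc⟩ (h : q < p ∨ q = p ∧ c = 1)
    dsimp only at hp hq hc
    change q' < p' ∨ q' = p' ∧ c' = 1
    have hle : q ≤ p := h.elim le_of_lt fun h => h.1.le
    rcases ((hq.trans hle).trans hp).lt_or_eq with hlt | rfl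
    · exact .inl hlt
    · obtain rfl : p = q' := hp.antisymm (hq.trans hle)
      obtain rfl : q = p := hle.antisymm hq
      have hc1 : c = 1 := (h.resolve_left (lt_irrefl q)).2
      exact .inr ⟨rfl, (Fin.le_last c').antisymm (hc1.ge.trans (hc rfl rfl))⟩

theorem rel_eps {p q : Q} : (eps Q).Rel p q ↔ q ≤ p :=
  ⟨fun ⟨_, h⟩ => h.elim le_of_lt fun h => h.1.le,
    fun h => ⟨1, h.lt_or_eq.imp_right fun h => ⟨h, rfl⟩⟩⟩

theorem zero_mem_eps {p q : Q} : (p, 0, q) ∈ (eps Q).carrier ↔ q < p := by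
  simp [eps]

end UpTile

/-- `p` is, from some time on, a path over the sequence `w` of tiles, and it takes infinitely many
Büchi transitions. Finitely many steps are left unconstrained, so that no initial condition has to
be carried along. -/
def IsBuchiPath (w : ℕ → UpTile Q) (p : ℕ → Q) : Prop :=
  (∀ᶠ k in atTop, (w k).Rel (p k) (p (k + 1))) ∧
    ∃ᶠ k in atTop, (p k, 0, p (k + 1)) ∈ (w k).carrier

theorem IsBuchiPath.comp_of_eps {u : ℕ → UpTile Q} {x : ℕ → Q} {g : ℕ → ℕ}
    (hx : IsBuchiPath u x) (hg : StrictMono g) (hu : ∀ m ∉ Set.range g, u m = UpTile.eps Q) :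
    IsBuchiPath (u ∘ g) (x ∘ g) := by
  obtain ⟨K, hK⟩ := eventually_atTop.1 hx.1
  have hanti (k) (hk : K ≤ k) : AntitoneOn x (Set.Icc (g k + 1) (g (k + 1))) := by
    refine antitoneOn_of_add_one_le Set.ordConnected_Icc fun m _ hm hm' => ?_
    have hrel := hK m (by have := hg.le_apply (x := k); grind)
    rwa [hu m (notMem_range_of_mem_Ioo hg (k := k) (by grind)), UpTile.rel_eps] at hrel
  have hrel (k) (hk : K ≤ k) : (u (g k)).Rel (x (g k)) (x (g k + 1)) :=
    hK _ (hk.trans hg.le_apply)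
  have hlt (k) : g k + 1 ≤ g (k + 1) := hg k.lt_succ_self
  have hle (k) (hk : K ≤ k) : x (g (k + 1)) ≤ x (g k + 1) :=
    hanti k hk ⟨le_rfl, hlt k⟩ ⟨hlt k, le_rfl⟩ (hlt k)
  refine ⟨eventually_atTop.2 ⟨K, fun k hk => rel_of_le (hrel k hk) le_rfl (hle k hk)⟩,
    frequently_atTop.2 fun N => ?_⟩
  obtain ⟨m, hm, hbuchi⟩ := frequently_atTop.1 hx.2 (g (max N K))
  obtain ⟨k, hk, hkm, hmk⟩ := exists_mem_Ico_of_strictMono hg hm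
  have hKk : K ≤ k := (le_max_right N K).trans hk
  refine ⟨k, (le_max_left N K).trans hk, ?_⟩
  rcases hkm.eq_or_lt with rfl | hkm
  · exact UpTile.mem_of_le hbuchi le_rfl (hle k hKk)
  · rw [hu m (notMem_range_of_mem_Ioo hg ⟨hkm, hmk⟩), UpTile.zero_mem_eps] at hbuchi
    refine UpTile.mem_of_lt_right (hrel k hKk) ?_ 0
    calc x (g (k + 1)) ≤ x (m + 1) := hanti k hKk ⟨by lia, hmk⟩ ⟨hlt k, le_rfl⟩ hmk
      _ < x m := hbuchi
      _ ≤ x (g k + 1) := hanti k hKk ⟨le_rfl, hlt k⟩ ⟨hkm, hmk.le⟩ hkm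

end Tiles

theorem getElem?_filterMap_length_filter_lt {α β : Type*} [LinearOrder α] {f : α → Option β}
    {l : List α} (hl : l.Pairwise (· < ·)) (hf : ∀ x ∈ l, f x ≠ none) {a : α} (ha : a ∈ l) :
    (l.filterMap f)[(l.filter (· < a)).length]? = f a := by
  induction l with
  | nil => simp at ha
  | cons b l ih =>
    obtain ⟨hb, hl⟩ := List.pairwise_cons.1 hl
    obtain ⟨y, hy⟩ := Option.ne_none_iff_exists'.1 (hf b List.mem_cons_self)
    rcases List.mem_cons.1 ha with rfl | ha
    · have hnil : l.filter (· < a) = [] :=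
        List.filter_eq_nil_iff.2 fun x hx => by simpa using (hb x hx).le
      simp [hy, hnil]
    · simp [hy, hb a ha, ih hl (fun x hx => hf x (List.mem_cons_of_mem b hx)) ha]

namespace Record

section Entries

variable {Q : Type*} [LinearOrder Q] {s s' : Record Q} {i j : ℕ} {q : Q}

theorem entry_eq_coe : s.entry i = q ↔ s.toList[i]? = some q := by
  unfold entry
  cases s.toList[i]? <;> simp

theorem entry_eq_bot : s.entry i = ⊥ ↔ s.toList.length ≤ i := by
  unfold entry
  rw [← List.getElem?_eq_none_iff]
  cases s.toList[i]? <;> simp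

theorem exists_entry_eq (hi : i < s.toList.length) : ∃ a : Q, s.entry i = a :=
  ⟨s.toList[i], entry_eq_coe.2 (List.getElem?_eq_getElem hi)⟩

theorem exists_entry_eq_of_mem (hq : q ∈ s.toList) : ∃ i, s.entry i = q :=
  (List.getElem?_of_mem hq).imp fun _ => entry_eq_coe.2

theorem mem_of_le_entry (h : (q : WithBot Q) ≤ s.entry i) : q ∈ s.toList := by
  obtain ⟨a, ha⟩ := WithBot.ne_bot_iff_exists.1 (ne_bot_of_le_ne_bot WithBot.coe_ne_bot h)
  rw [← ha, WithBot.coe_le_coe] at h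
  exact s.lower h (List.mem_of_getElem? (entry_eq_coe.1 ha.symm))

theorem mem_iff_le_entry_zero : q ∈ s.toList ↔ (q : WithBot Q) ≤ s.entry 0 := by
  refine ⟨fun h => ?_, mem_of_le_entry⟩
  obtain ⟨a, ha⟩ := exists_entry_eq (List.length_pos_of_mem h)
  rw [ha, WithBot.coe_le_coe]
  exact s.head_max a (List.head?_eq_getElem? ▸ entry_eq_coe.1 ha) q h

theorem length_eq_of_entry_zero_eq (h : s.entry 0 = s'.entry 0) :
    s.toList.length = s'.toList.length :=
  ((List.perm_ext_iff_of_nodup s.nodup s'.nodup).2 fun q => by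
    rw [mem_iff_le_entry_zero, h, mem_iff_le_entry_zero]).length_eq

theorem length_le_card [Fintype Q] (s : Record Q) : s.toList.length ≤ Fintype.card Q :=
  s.nodup.length_le_card

theorem entry_le_of_pre_le (h : s'.pre i ≤ s.pre i) (hj : j ≤ i)
    (heq : ∀ j' < j, s'.entry j' = s.entry j') : s'.entry j ≤ s.entry j :=
  Pi.apply_le_of_toLex (i := (⟨j, Nat.lt_succ_of_le hj⟩ : Fin (i + 1))) h fun j' hj' => heq j' hj'

theorem pre_le_of_le (h : s'.pre i ≤ s.pre i) (hj : j ≤ i) : s'.pre j ≤ s.pre j := by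
  by_contra! hlt
  obtain ⟨a, heq, hlt⟩ := hlt
  exact hlt.not_ge (entry_le_of_pre_le h ((Nat.lt_succ_iff.1 a.2).trans hj)
    fun j' hj' => (heq ⟨j', hj'.trans a.2⟩ hj').symm)

theorem exists_entry_lt_of_pre_lt (h : s'.pre i < s.pre i) : ∃ j ≤ i, s'.entry j < s.entry j :=
  let ⟨a, _, hlt⟩ := h
  ⟨a, Nat.lt_succ_iff.1 a.2, hlt⟩

theorem mem_of_pre_le (h : s'.pre i ≤ s.pre i) (hq : q ∈ s'.toList) : q ∈ s.toList := by
  rw [mem_iff_le_entry_zero] at *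
  exact hq.trans (entry_le_of_pre_le h i.zero_le (by simp))

end Entries

theorem minOr_le {m x : ℕ} {X : Finset ℕ} (h : x ∈ X) : minOr m X ≤ x := by
  rw [minOr, dif_pos ⟨x, h⟩]
  exact Finset.min'_le _ _ h

theorem minOr_mem_or_eq (m : ℕ) (X : Finset ℕ) : minOr m X ∈ X ∨ minOr m X = m := by
  unfold minOr
  split_ifs with h
  · exact .inl (X.min'_mem h)
  · exact .inr rfl

section Next

variable {Q : Type*} [LinearOrder Q] [Fintype Q]

/-- The index in the next record of the path that has index `l` in `s`, when `l` is a leader. -/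
noncomputable def nextIndex (s : Record Q) (t : UpTile Q) (l : ℕ) : ℕ :=
  ((s.leaders t).filter (· < l)).card

variable {s : Record Q} {t : UpTile Q} {i j l r : ℕ} {p p' q : Q}

theorem next_getElem?_nextIndex (hl : l ∈ s.leaders t) :
    (s.next t).toList[s.nextIndex t l]? = s.best t l := by
  have hsorted : ((s.leaders t).sort (· ≤ ·)).Pairwise (· < ·) :=
    (Finset.sortedLT_sort _).pairwise
  have hlength : (((s.leaders t).sort (· ≤ ·)).filter (· < l)).length = s.nextIndex t l := by
    rw [← List.toFinset_card_of_nodup (hsorted.nodup.filter _), nextIndex]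
    congr 1
    ext x
    simp
  have hget := hlength ▸ getElem?_filterMap_length_filter_lt hsorted
    (fun x hx => (mem_leaders.1 ((Finset.mem_sort _).1 hx)).2.1) ((Finset.mem_sort _).2 hl)
  obtain ⟨b, hb⟩ := Option.ne_none_iff_exists'.1 (mem_leaders.1 hl).2.1
  change (_ ++ _)[_]? = _
  rw [List.getElem?_append_left (List.getElem?_eq_some_iff.1 (hget.trans hb)).1, hget]

theorem nextIndex_le (s : Record Q) (t : UpTile Q) (l : ℕ) : s.nextIndex t l ≤ l :=
  calc s.nextIndex t l ≤ (Finset.range l).card := Finset.card_le_card fun x => by simp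
    _ = l := Finset.card_range l

theorem nextIndex_lt (hr : r < l) (h : r ∉ s.leaders t) : s.nextIndex t l < l :=
  calc s.nextIndex t l < (Finset.range l).card := Finset.card_lt_card
        ⟨fun x => by simp, fun hs => h (Finset.mem_filter.1 (hs (Finset.mem_range.2 hr))).1⟩
    _ = l := Finset.card_range l

theorem nextIndex_eq_self (h : ∀ i < l, i ∈ s.leaders t) : s.nextIndex t l = l := by
  have hfilter : (s.leaders t).filter (· < l) = Finset.range l := by
    ext i
    simpa using h i
  rw [nextIndex, hfilter, Finset.card_range]

theorem exists_leader_le (hi : i < s.toList.length) (h : s.best t i ≠ none) :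
    ∃ l ∈ s.leaders t, l ≤ i ∧ s.best t l = s.best t i := by
  classical
  have hex : ∃ l, s.best t l = s.best t i := ⟨i, rfl⟩
  have hle : Nat.find hex ≤ i := Nat.find_min' hex rfl
  have hbest := Nat.find_spec hex
  exact ⟨Nat.find hex, mem_leaders.2 ⟨hle.trans_lt hi, by rwa [hbest],
    fun j hj heq => Nat.find_min hex hj (heq.trans hbest)⟩, hle, hbest⟩

theorem mem_next : q ∈ (s.next t).toList ↔ ∃ p ∈ s.toList, t.Rel p q := mem_nextList

theorem length_next (s : Record Q) (t : UpTile Q) :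
    (s.next t).toList.length = (s.succStates t).card := by
  rw [← List.toFinset_card_of_nodup (s.next t).nodup]
  congr 1
  ext q
  simp [mem_next, succStates]

theorem mem_leaders_of_lt_red (hj : j < s.toList.length) (h : j < s.red t) :
    j ∈ s.leaders t := by
  by_contra hj'
  have : s.red t ≤ j := minOr_le (by simpa using ⟨hj, hj'⟩)
  lia

theorem red_spec (s : Record Q) (t : UpTile Q) :
    (s.red t < s.toList.length ∧ s.red t ∉ s.leaders t) ∨
      s.red t = (s.next t).toList.length := by
  rw [length_next]
  exact (minOr_mem_or_eq _ _).imp_left fun h => by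
    rwa [Finset.mem_sdiff, Finset.mem_range] at h

theorem exists_isGreatest_of_lt_red (hj : j < s.toList.length) (h : j < s.red t) :
    ∃ a b : Q, s.entry j = a ∧ (s.next t).entry j = b ∧ IsGreatest {q | t.Rel a q} b := by
  have hleader (i) (hi : i ≤ j) : i ∈ s.leaders t :=
    mem_leaders_of_lt_red (hi.trans_lt hj) (hi.trans_lt h)
  have hnext := next_getElem?_nextIndex (hleader j le_rfl)
  obtain ⟨b, hb⟩ := Option.ne_none_iff_exists'.1 (mem_leaders.1 (hleader j le_rfl)).2.1
  obtain ⟨a, ha, hab⟩ := best_eq_some hb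
  rw [nextIndex_eq_self fun i hi => hleader i hi.le, hb] at hnext
  exact ⟨a, b, entry_eq_coe.2 ha, entry_eq_coe.2 hnext, ska_eq_some hab⟩

theorem red_le_length_next (s : Record Q) (t : UpTile Q) :
    s.red t ≤ (s.next t).toList.length := by
  by_contra! hlt
  have hred := ((red_spec s t).resolve_right hlt.ne').1
  obtain ⟨_, b, -, hb, -⟩ := exists_isGreatest_of_lt_red (hlt.trans hred) hlt
  exact WithBot.coe_ne_bot (hb.symm.trans (entry_eq_bot.2 le_rfl))

theorem red_pos (hq : q ∈ (s.next t).toList) : 0 < s.red t := by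
  rcases red_spec s t with ⟨hlt, hnot⟩ | h
  · refine Nat.pos_of_ne_zero fun h0 => hnot ?_
    rw [h0] at hlt ⊢
    obtain ⟨p, hp, hpq⟩ := mem_next.1 hq
    obtain ⟨a, ha⟩ := exists_entry_eq hlt
    have hpa : p ≤ a := WithBot.coe_le_coe.1 (ha ▸ mem_iff_le_entry_zero.1 hp)
    obtain ⟨b, hb⟩ := ska_exists (rel_of_le hpq hpa le_rfl)
    exact mem_leaders.2 ⟨hlt, by simp [best, entry_eq_coe.1 ha, hb], by simp⟩
  · exact h ▸ List.length_pos_of_mem hq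

theorem green_le {a b : Q} (ha : s.entry j = a) (hb : (s.next t).entry j = b)
    (h : (a, 0, b) ∈ t.carrier) : s.green t ≤ j := by
  classical
  rw [entry_eq_coe] at ha hb
  exact minOr_le (Finset.mem_filter.2
    ⟨Finset.mem_range.2 (List.getElem?_eq_some_iff.1 ha).1, a, b, ha, hb, h⟩)

theorem exists_mem_of_green_lt_red (h : s.green t < s.red t) :
    ∃ a b : Q, s.entry (s.green t) = a ∧ (s.next t).entry (s.green t) = b ∧
      (a, 0, b) ∈ t.carrier := by
  classical
  simp only [entry_eq_coe]
  have hgreen : s.green t ∈ _ ∨ s.green t = (s.succStates t).card := minOr_mem_or_eq _ _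
  rcases hgreen with hmem | heq
  · exact (Finset.mem_filter.1 hmem).2
  · have := red_le_length_next s t
    rw [length_next] at this
    lia

theorem prio_mem_Icc (s : Record Q) (t : UpTile Q) :
    s.prio t ∈ Set.Icc (-1 : ℤ) (2 * Fintype.card Q - 1) := by
  have := red_le_length_next s t
  have := length_le_card (s.next t)
  constructor <;> simp only [prio] <;> lia

theorem prio_eq_neg_one_iff : s.prio t = -1 ↔ (s.next t).toList = [] := by
  constructor
  · refine fun h => List.eq_nil_iff_forall_not_mem.2 fun q hq => ?_
    have := red_pos hq
    simp only [prio] at h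
    lia
  · intro h
    have := red_le_length_next s t
    simp only [h, List.length_nil] at this
    simp only [prio]
    lia

theorem le_next_entry (hj : j < s.toList.length) (hred : j < s.red t)
    (hp : (p : WithBot Q) ≤ s.entry j) (h : t.Rel p p') :
    (p' : WithBot Q) ≤ (s.next t).entry j := by
  obtain ⟨a, b, ha, hb, hab⟩ := exists_isGreatest_of_lt_red hj hred
  rw [ha, WithBot.coe_le_coe] at hp
  exact hb ▸ WithBot.coe_le_coe.2 (hab.2 (rel_of_le h hp le_rfl))

/-- The transition over `t` neither forgets a path of index at most `j` nor lets one of them take a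
Büchi transition along its own entry. -/
structure IsQuiet (s : Record Q) (t : UpTile Q) (j : ℕ) : Prop where
  lt_length : j < s.toList.length
  lt_red : j < s.red t
  lt_green : j < s.green t

theorem IsQuiet.lt_next_entry_of_zero_mem (hj : s.IsQuiet t j)
    (hp : (p : WithBot Q) ≤ s.entry j) (h : (p, 0, p') ∈ t.carrier) :
    (p' : WithBot Q) < (s.next t).entry j := by
  refine (le_next_entry hj.lt_length hj.lt_red hp ⟨0, h⟩).lt_of_ne fun heq =>
    hj.lt_green.not_ge ?_
  obtain ⟨a, ha⟩ := exists_entry_eq hj.lt_length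
  rw [ha, WithBot.coe_le_coe] at hp
  exact green_le ha heq.symm (UpTile.mem_of_le h hp le_rfl)

theorem IsQuiet.lt_next_entry_of_lt (hj : s.IsQuiet t j) (hp : (p : WithBot Q) < s.entry j)
    (h : t.Rel p p') : (p' : WithBot Q) < (s.next t).entry j := by
  obtain ⟨a, ha⟩ := exists_entry_eq hj.lt_length
  rw [ha, WithBot.coe_lt_coe] at hp
  exact hj.lt_next_entry_of_zero_mem ha.ge (UpTile.mem_of_lt_left h hp 0)

end Next

end Record

section PathsInRuns

variable {Q : Type*} [LinearOrder Q]

namespace Record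

/-- The indices of the paths of a record that lie above `p` and below all the paths with an index
in `J`. When the paths with an index in `J` are never forgotten, the least covering index behaves
as a rank: it cannot increase along a path, and drops when a smaller index is forgotten. -/
def coveringIndices (s : Record Q) (J : Set ℕ) (p : Q) : Set ℕ :=
  {i | (p : WithBot Q) ≤ s.entry i ∧ ∀ j ∈ J, s.entry i < s.entry j}

variable {s : Record Q} {J : Set ℕ} {p : Q}

theorem coveringIndices_nonempty (hp : p ∈ s.toList)
    (hJ : ∀ j ∈ J, (p : WithBot Q) < s.entry j) : (s.coveringIndices J p).Nonempty :=
  let ⟨i, hi⟩ := exists_entry_eq_of_mem hp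
  ⟨i, hi.ge, fun j hj => hi ▸ hJ j hj⟩

variable [Fintype Q] {t : UpTile Q} {i l : ℕ} {p' : Q}

theorem exists_nextIndex_mem_coveringIndices
    (hJ : ∀ j ∈ J, s.IsQuiet t j)
    (hi : i ∈ s.coveringIndices J p) (h : t.Rel p p') :
    ∃ l ∈ s.leaders t, l ≤ i ∧ s.nextIndex t l ∈ (s.next t).coveringIndices J p' := by
  obtain ⟨hpi, hiJ⟩ := hi
  obtain ⟨a, ha⟩ := WithBot.ne_bot_iff_exists.1 (ne_bot_of_le_ne_bot WithBot.coe_ne_bot hpi)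
  have hpa : p ≤ a := WithBot.coe_le_coe.1 (ha ▸ hpi)
  obtain ⟨b, hb⟩ := ska_exists (rel_of_le h hpa le_rfl)
  obtain ⟨hab, hmax⟩ := ska_eq_some hb
  have hai := entry_eq_coe.1 ha.symm
  have hbest : s.best t i = some b := by simp [best, hai, hb]
  obtain ⟨l, hl, hli, hlbest⟩ :=
    exists_leader_le (List.getElem?_eq_some_iff.1 hai).1 (hbest ▸ Option.some_ne_none b)
  have hentry : (s.next t).entry (s.nextIndex t l) = b :=
    entry_eq_coe.2 ((next_getElem?_nextIndex hl).trans (hlbest.trans hbest))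
  refine ⟨l, hl, hli, hentry ▸ WithBot.coe_le_coe.2 (hmax p' (rel_of_le h hpa le_rfl)),
    fun j hj => ?_⟩
  exact hentry ▸ (hJ j hj).lt_next_entry_of_lt (ha ▸ hiJ j hj) hab

theorem nextIndex_lt_of_red_le (hl : l ∈ s.leaders t) (h : s.red t ≤ s.nextIndex t l) :
    s.nextIndex t l < l := by
  rcases red_spec s t with ⟨-, hred⟩ | hred
  · exact nextIndex_lt ((h.trans (nextIndex_le s t l)).lt_of_ne fun heq => hred (heq ▸ hl)) hred
  · obtain ⟨b, hb⟩ := Option.ne_none_iff_exists'.1 (mem_leaders.1 hl).2.1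
    have hlt := (List.getElem?_eq_some_iff.1 ((next_getElem?_nextIndex hl).trans hb)).1
    lia

theorem sInf_coveringIndices_next_le
    (hJ : ∀ j ∈ J, s.IsQuiet t j)
    (hne : (s.coveringIndices J p).Nonempty) (h : t.Rel p p') :
    sInf ((s.next t).coveringIndices J p') ≤ sInf (s.coveringIndices J p) :=
  let ⟨l, _, hli, hmem⟩ := exists_nextIndex_mem_coveringIndices hJ (Nat.sInf_mem hne) h
  (Nat.sInf_le hmem).trans ((nextIndex_le s t l).trans hli)

theorem sInf_coveringIndices_next_lt
    (hJ : ∀ j ∈ J, s.IsQuiet t j)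
    (hne : (s.coveringIndices J p).Nonempty) (h : t.Rel p p')
    (hred : ∀ i ∈ (s.next t).coveringIndices J p', s.red t ≤ i) :
    sInf ((s.next t).coveringIndices J p') < sInf (s.coveringIndices J p) :=
  let ⟨_, hl, hli, hmem⟩ := exists_nextIndex_mem_coveringIndices hJ (Nat.sInf_mem hne) h
  (Nat.sInf_le hmem).trans_lt ((nextIndex_lt_of_red_le hl (hred _ hmem)).trans_le hli)

end Record

open Record

variable {w : ℕ → UpTile Q} {s : ℕ → Record Q} {p : ℕ → Q} {r : ℕ}

/-- The indices below `r` of the paths of a sequence `s` of records that stay strictly above `p`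
from some time on. -/
def indicesAbove (s : ℕ → Record Q) (p : ℕ → Q) (r : ℕ) : Set ℕ :=
  {j | j < r ∧ ∀ᶠ k in atTop, (p k : WithBot Q) < (s k).entry j}

theorem eventually_coveringIndices_nonempty (hmem : ∀ᶠ k in atTop, p k ∈ (s k).toList) :
    ∀ᶠ k in atTop, ((s k).coveringIndices (indicesAbove s p r) (p k)).Nonempty := by
  have hfin : (indicesAbove s p r).Finite := (Set.finite_Iio r).subset fun j hj => hj.1
  filter_upwards [hmem, (eventually_all_finite hfin).2 fun j hj => hj.2] with k
    using coveringIndices_nonempty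

variable [Fintype Q]

theorem eventually_lt_entry_or_eventually_entry_lt (hs : ∀ k, s (k + 1) = (s k).next (w k))
    (hp : IsBuchiPath w p) {j : ℕ} (hj : ∀ᶠ k in atTop, (s k).IsQuiet (w k) j) :
    (∀ᶠ k in atTop, (p k : WithBot Q) < (s k).entry j) ∨
      ∀ᶠ k in atTop, (s k).entry j < (p k : WithBot Q) := by
  by_cases hfreq : ∃ᶠ k in atTop, (p k : WithBot Q) ≤ (s k).entry j
  · left
    have hle := eventually_of_frequently_of_step hfreq <| by
      filter_upwards [hp.1, hj] with k hrel hj hle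
      exact hs k ▸ le_next_entry hj.lt_length hj.lt_red hle hrel
    have hlt : ∃ᶠ k in atTop, (p (k + 1) : WithBot Q) < (s (k + 1)).entry j :=
      (hp.2.and_eventually (hle.and hj)).mono fun k ⟨hmem, hle, hj⟩ =>
        hs k ▸ hj.lt_next_entry_of_zero_mem hle hmem
    refine eventually_of_frequently_of_step ((tendsto_add_atTop_nat 1).frequently hlt) ?_
    filter_upwards [hp.1, hj] with k hrel hj hlt
    exact hs k ▸ hj.lt_next_entry_of_lt hlt hrel
  · right
    simpa only [not_frequently, not_le] using hfreq

theorem eventually_le_of_mem_coveringIndices (hs : ∀ k, s (k + 1) = (s k).next (w k))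
    (hp : IsBuchiPath w p) (hquiet : ∀ᶠ k in atTop, ∀ j < r, (s k).IsQuiet (w k) j) :
    ∀ᶠ k in atTop, ∀ i ∈ (s k).coveringIndices (indicesAbove s p r) (p k), r ≤ i := by
  have hnot (i) (hi : i < r) :
      ∀ᶠ k in atTop, i ∉ (s k).coveringIndices (indicesAbove s p r) (p k) := by
    rcases eventually_lt_entry_or_eventually_entry_lt hs hp (hquiet.mono fun k h => h i hi)
      with h | h
    · exact .of_forall fun k hmem => (hmem.2 i ⟨hi, h⟩).false
    · exact h.mono fun k hlt hmem => hmem.1.not_gt hlt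
  filter_upwards [(eventually_all_finite (Set.finite_Iio r)).2 hnot] with k hk i hi
  exact not_lt.1 fun hlt => hk i hlt hi

theorem eventually_red_ne (hs : ∀ k, s (k + 1) = (s k).next (w k)) (hp : IsBuchiPath w p)
    (hmem : ∀ᶠ k in atTop, p k ∈ (s k).toList)
    (hquiet : ∀ᶠ k in atTop, ∀ j < r, (s k).IsQuiet (w k) j) :
    ∀ᶠ k in atTop, (s k).red (w k) ≠ r := by
  have hne := eventually_coveringIndices_nonempty (r := r) hmem
  have hcover := eventually_le_of_mem_coveringIndices hs hp hquiet
  have heq : ∀ᶠ k in atTop, sInf ((s (k + 1)).coveringIndices (indicesAbove s p r) (p (k + 1))) =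
      sInf ((s k).coveringIndices (indicesAbove s p r) (p k)) := by
    refine eventually_succ_eq_of_eventually_succ_le
      (f := fun k => sInf ((s k).coveringIndices (indicesAbove s p r) (p k))) ?_
    filter_upwards [hquiet, hne, hp.1] with k hquiet hne hrel
    exact hs k ▸ sInf_coveringIndices_next_le (fun j hj => hquiet j hj.1) hne hrel
  filter_upwards [hquiet, hne, hp.1, heq, (tendsto_add_atTop_nat 1).eventually hcover]
    with k hquiet hne hrel heq hcover hr
  rw [hs k] at heq hcover
  exact (sInf_coveringIndices_next_lt (fun j hj => hquiet j hj.1) hne hrel (hr ▸ hcover)).ne heq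

theorem eventually_isQuiet (hs : ∀ k, s (k + 1) = (s k).next (w k))
    (hred : ∀ᶠ k in atTop, r ≤ (s k).red (w k))
    (hgreen : ∀ᶠ k in atTop, r ≤ (s k).green (w k)) :
    ∀ᶠ k in atTop, ∀ j < r, (s k).IsQuiet (w k) j := by
  have hlength : ∀ᶠ k in atTop, r ≤ (s k).toList.length := by
    obtain ⟨K, hK⟩ := eventually_atTop.1 hred
    refine eventually_atTop.2 ⟨K + 1, fun k hk => ?_⟩
    obtain ⟨k, rfl⟩ := Nat.exists_eq_add_of_le' ((Nat.le_add_left 1 K).trans hk)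
    exact hs k ▸ (hK k (by lia)).trans (red_le_length_next _ _)
  filter_upwards [hlength, hred, hgreen] with k h₁ h₂ h₃ j hj
  exact ⟨hj.trans_le h₁, hj.trans_le h₂, hj.trans_le h₃⟩

theorem parityAccepting_prio_of_isBuchiPath (hs : ∀ k, s (k + 1) = (s k).next (w k))
    (hp : IsBuchiPath w p) (hmem : ∀ᶠ k in atTop, p k ∈ (s k).toList) :
    ParityAccepting fun k => (s k).prio (w k) := by
  obtain ⟨m, hle, heq⟩ :=
    exists_eventually_le_and_frequently_eq fun k => (s k).prio_mem_Icc (w k)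
  refine ⟨m, Int.not_odd_iff_even.1 fun hodd => ?_, hle, heq⟩
  obtain ⟨r, rfl⟩ : ∃ r : ℕ, m = 2 * r - 1 := by
    obtain ⟨k, hk⟩ := heq.exists
    obtain ⟨l, rfl⟩ := hodd
    have := ((s k).prio_mem_Icc (w k)).1
    exact ⟨(l + 1).toNat, by lia⟩
  simp only [prio] at hle heq
  have hred : ∀ᶠ k in atTop, r ≤ (s k).red (w k) := hle.mono fun k hk => by lia
  have hgreen : ∀ᶠ k in atTop, r ≤ (s k).green (w k) := hle.mono fun k hk => by lia
  have hne := eventually_red_ne hs hp hmem (eventually_isQuiet hs hred hgreen)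
  exact heq (hne.mono fun k hk h => by lia)

end PathsInRuns

section EpsSteps

variable {Q : Type*} [LinearOrder Q] [Fintype Q] {B : OrderedBuchiAutomaton Q}
  {s s' : Record Q} {t : B.tiles} {o : Option B.tiles} {a b : Q} {c : ℤ} {e j : ℕ}

open Record

theorem mem_epsTransitions : (s, c, s') ∈ epsTransitions Q ↔
    ∃ i < Fintype.card Q, s'.pre i < s.pre i ∧ c = 2 * i ∨ s'.pre i ≤ s.pre i ∧ c = 2 * i + 1 := by
  constructor
  · rintro ⟨i, _, _, hi, ⟨h, heq⟩ | ⟨h, heq⟩⟩ <;> cases heq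
    · exact ⟨i, hi, .inl ⟨h, rfl⟩⟩
    · exact ⟨i, hi, .inr ⟨h, rfl⟩⟩
  · rintro ⟨i, hi, ⟨h, rfl⟩ | ⟨h, rfl⟩⟩
    · exact ⟨i, s, s', hi, .inl ⟨h, rfl⟩⟩
    · exact ⟨i, s', s, hi, .inr ⟨h, rfl⟩⟩

theorem pre_le_of_mem_epsTransitions (h : (s, c, s') ∈ epsTransitions Q) (hc : 2 * (e : ℤ) ≤ c) :
    s'.pre e ≤ s.pre e := by
  obtain ⟨i, -, ⟨hpre, rfl⟩ | ⟨hpre, rfl⟩⟩ := mem_epsTransitions.1 h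
  · exact pre_le_of_le hpre.le (by lia)
  · exact pre_le_of_le hpre (by lia)

theorem even_mem_epsTransitions :
    (s, 2 * (e : ℤ), s') ∈ epsTransitions Q ↔ e < Fintype.card Q ∧ s'.pre e < s.pre e := by
  refine mem_epsTransitions.trans ⟨?_, fun ⟨he, h⟩ => ⟨e, he, .inl ⟨h, rfl⟩⟩⟩
  rintro ⟨i, hi, ⟨h, hc⟩ | ⟨-, hc⟩⟩
  · obtain rfl : e = i := by lia
    exact ⟨hi, h⟩
  · lia

theorem odd_mem_epsTransitions :
    (s, 2 * (e : ℤ) + 1, s') ∈ epsTransitions Q ↔ e < Fintype.card Q ∧ s'.pre e ≤ s.pre e := by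
  refine mem_epsTransitions.trans ⟨?_, fun ⟨he, h⟩ => ⟨e, he, .inr ⟨h, rfl⟩⟩⟩
  rintro ⟨i, hi, ⟨-, hc⟩ | ⟨h, hc⟩⟩
  · lia
  · obtain rfl : e = i := by lia
    exact ⟨hi, h⟩

theorem mem_of_mem_epsTransitions (h : (s, c, s') ∈ epsTransitions Q) (ha : a ∈ s'.toList) :
    a ∈ s.toList := by
  obtain ⟨i, -, ⟨h, -⟩ | ⟨h, -⟩⟩ := mem_epsTransitions.1 h
  exacts [mem_of_pre_le h.le ha, mem_of_pre_le h ha]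

theorem some_mem_trans_addEps :
    (s, some t, c, s') ∈ (B.det.addEps (epsTransitions Q)).trans ↔
      c = s.prio t ∧ s' = s.next t := by
  simp [ParityAutomaton.addEps, OrderedBuchiAutomaton.det]

theorem none_mem_trans_addEps {Letter State : Type*} {A : ParityAutomaton Letter State}
    {E : Set (State × ℤ × State)} {p q : State} :
    (p, none, c, q) ∈ (A.addEps E).trans ↔ (p, c, q) ∈ E := by
  simp [ParityAutomaton.addEps]

theorem neg_one_le_of_mem_trans (h : (s, o, c, s') ∈ (B.det.addEps (epsTransitions Q)).trans) :
    -1 ≤ c := by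
  cases o with
  | none => obtain ⟨i, -, h⟩ := mem_epsTransitions.1 (none_mem_trans_addEps.1 h); lia
  | some t => exact (some_mem_trans_addEps.1 h).1 ▸ (prio_mem_Icc _ _).1

theorem lt_length_of_mem_trans (h : (s, o, c, s') ∈ (B.det.addEps (epsTransitions Q)).trans)
    (hc : 2 * (e : ℤ) ≤ c) (ho : o ≠ none) : e < s'.toList.length := by
  obtain ⟨t, rfl⟩ := Option.ne_none_iff_exists'.1 ho
  obtain ⟨rfl, rfl⟩ := some_mem_trans_addEps.1 h
  have := red_le_length_next s t.1
  simp only [prio] at hc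
  lia

theorem exists_mem_of_mem_trans (h : (s, o, c, s') ∈ (B.det.addEps (epsTransitions Q)).trans)
    (hne : ∃ a, a ∈ s'.toList) : ∃ a, a ∈ s.toList := by
  obtain ⟨a, ha⟩ := hne
  cases o with
  | none => exact ⟨a, mem_of_mem_epsTransitions (none_mem_trans_addEps.1 h) ha⟩
  | some t =>
    rw [(some_mem_trans_addEps.1 h).2, mem_next] at ha
    exact ha.imp fun _ h => h.1

/-- The tile of a letter of an `ε`-automaton built from `B`, where `ε` stands for `UpTile.eps`. -/
def letterTile (o : Option B.tiles) : UpTile Q := o.elim (UpTile.eps Q) Subtype.val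

theorem rel_letterTile (h : (s, o, c, s') ∈ (B.det.addEps (epsTransitions Q)).trans)
    (hc : 2 * (e : ℤ) ≤ c) (hj : j ≤ e) (hbelow : o = none → ∀ i < j, s'.entry i = s.entry i)
    (ha : s.entry j = a) (hb : s'.entry j = b) : (letterTile o).Rel a b := by
  cases o with
  | none =>
    have hpre := pre_le_of_mem_epsTransitions (none_mem_trans_addEps.1 h) hc
    have hle := entry_le_of_pre_le hpre hj (hbelow rfl)
    rw [ha, hb, WithBot.coe_le_coe] at hle
    exact UpTile.rel_eps.2 hle
  | some t =>
    obtain ⟨rfl, rfl⟩ := some_mem_trans_addEps.1 h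
    have hlength : j < s.toList.length := by
      by_contra! hle
      exact WithBot.coe_ne_bot (ha.symm.trans (entry_eq_bot.2 hle))
    obtain ⟨a', b', ha', hb', hab⟩ := exists_isGreatest_of_lt_red (t := t.1) hlength
      (by simp only [prio] at hc; lia)
    obtain rfl : a = a' := WithBot.coe_injective (ha.symm.trans ha')
    obtain rfl : b = b' := WithBot.coe_injective (hb.symm.trans hb')
    exact hab.1

theorem zero_mem_of_prio_eq {t : UpTile Q} (h : s.prio t = 2 * e) (ha : s.entry e = a)
    (hb : (s.next t).entry e = b) : (a, 0, b) ∈ t.carrier := by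
  simp only [prio] at h
  obtain ⟨a', b', ha', hb', hab⟩ := exists_mem_of_green_lt_red (s := s) (t := t) (by lia)
  obtain rfl : e = s.green t := by lia
  obtain rfl : a = a' := WithBot.coe_injective (ha.symm.trans ha')
  obtain rfl : b = b' := WithBot.coe_injective (hb.symm.trans hb')
  exact hab

end EpsSteps

section EpsRuns

variable {Q : Type*} [LinearOrder Q] [Fintype Q] {B : OrderedBuchiAutomaton Q}
  {w : ℕ → Option B.tiles} {q : ℕ → Record Q} {c : ℕ → ℤ} {e j : ℕ}

open Record

/-- The transition at time `k` of the run `q` over `w` is an `ε`-transition that changes the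
entry of index `j`. -/
def EpsChangesEntry (w : ℕ → Option B.tiles) (q : ℕ → Record Q) (j k : ℕ) : Prop :=
  w k = none ∧ (q (k + 1)).entry j ≠ (q k).entry j

theorem frequently_lt_length
    (hq : ∀ k, (q k, w k, c k, q (k + 1)) ∈ (B.det.addEps (epsTransitions Q)).trans)
    (hw : ∃ᶠ k in atTop, w k ≠ none) (hc : ∀ᶠ k in atTop, 2 * (e : ℤ) ≤ c k) :
    ∃ᶠ k in atTop, e < (q k).toList.length :=
  (tendsto_add_atTop_nat 1).frequently
    ((hw.and_eventually hc).mono fun _ hk => lt_length_of_mem_trans (hq _) hk.2 hk.1)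

theorem eventually_exists_entry_eq
    (hq : ∀ k, (q k, w k, c k, q (k + 1)) ∈ (B.det.addEps (epsTransitions Q)).trans)
    (hw : ∃ᶠ k in atTop, w k ≠ none) (hc : ∀ᶠ k in atTop, 2 * (e : ℤ) ≤ c k) (hj : j ≤ e)
    (hbelow : ∀ᶠ k in atTop, ∀ i < j, ¬ EpsChangesEntry w q i k) :
    ∀ᶠ k in atTop, ∃ a : Q, (q k).entry j = a := by
  suffices hlength : ∀ᶠ k in atTop, j < (q k).toList.length from
    hlength.mono fun _ => exists_entry_eq
  have hfreq := frequently_lt_length hq hw hc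
  rcases j.eq_zero_or_pos with rfl | hpos
  · have hne := forall_of_frequently_of_step_back (P := fun k => ∃ a, a ∈ (q k).toList)
      (hfreq.mono fun k hk => ⟨_, List.getElem_mem hk⟩)
      (fun k => exists_mem_of_mem_trans (hq k))
    exact .of_forall fun k => List.length_pos_of_mem (hne k).choose_spec
  · refine (eventually_of_frequently_of_step hfreq ?_).mono fun k hk => hj.trans_lt hk
    filter_upwards [hc, hbelow] with k hc hbelow hk
    by_cases hwk : w k = none
    · have hentry : (q (k + 1)).entry 0 = (q k).entry 0 :=
        by_contra fun hne => hbelow 0 hpos ⟨hwk, hne⟩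
      rwa [length_eq_of_entry_zero_eq hentry]
    · exact lt_length_of_mem_trans (hq k) hc hwk

theorem exists_index_frequently_buchi
    (hq : ∀ k, (q k, w k, c k, q (k + 1)) ∈ (B.det.addEps (epsTransitions Q)).trans)
    (hc : ∃ᶠ k in atTop, c k = 2 * e) :
    ∃ j ≤ e, (∀ᶠ k in atTop, ∀ i < j, ¬ EpsChangesEntry w q i k) ∧
      ∃ᶠ k in atTop, EpsChangesEntry w q j k ∨ j = e ∧ c k = 2 * e ∧ w k ≠ none := by
  classical
  by_cases hex : ∃ j ≤ e, ∃ᶠ k in atTop, EpsChangesEntry w q j k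
  · obtain ⟨hj, hchange⟩ := Nat.find_spec hex
    exact ⟨Nat.find hex, hj, (eventually_all_finite (Set.finite_Iio _)).2 fun i hi =>
      not_frequently.1 fun h => Nat.find_min hex hi ⟨hi.le.trans hj, h⟩, hchange.mono fun _ => .inl⟩
  · push Not at hex
    have hstable := (eventually_all_finite (Set.finite_Iic e)).2 hex
    refine ⟨e, le_rfl, hstable.mono fun k hk i hi => hk i hi.le, ?_⟩
    refine (hc.and_eventually hstable).mono fun k ⟨hck, hk⟩ => .inr ⟨rfl, hck, fun hwk => ?_⟩
    have hlt := hwk ▸ hck ▸ hq k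
    rw [none_mem_trans_addEps, even_mem_epsTransitions] at hlt
    obtain ⟨i, hi, hlt⟩ := exists_entry_lt_of_pre_lt hlt.2
    exact hk i hi ⟨hwk, hlt.ne⟩

theorem exists_isBuchiPath_of_epsRun
    (hq : ∀ k, (q k, w k, c k, q (k + 1)) ∈ (B.det.addEps (epsTransitions Q)).trans)
    (hw : ∃ᶠ k in atTop, w k ≠ none) (hc : ParityAccepting c) :
    ∃ x : ℕ → Q, (∀ᶠ k in atTop, x k ∈ (q k).toList) ∧ IsBuchiPath (letterTile ∘ w) x := by
  obtain ⟨m, hm, hle, heq⟩ := hc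
  obtain ⟨e, rfl⟩ : ∃ e : ℕ, m = 2 * e := by
    obtain ⟨k, rfl⟩ := heq.exists
    have := neg_one_le_of_mem_trans (hq k)
    obtain ⟨l, hl⟩ := hm
    exact ⟨l.toNat, by lia⟩
  obtain ⟨j, hj, hbelow, hbuchi⟩ := exists_index_frequently_buchi hq heq
  obtain ⟨x, hx⟩ := (eventually_exists_entry_eq hq hw hle hj hbelow).choice
  have hx' := (tendsto_add_atTop_nat 1).eventually hx
  have hrel : ∀ᶠ k in atTop, (letterTile (w k)).Rel (x k) (x (k + 1)) := by
    filter_upwards [hle, hbelow, hx, hx'] with k hle hbelow hx hx'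
    exact rel_letterTile (hq k) hle hj
      (fun hwk i hi => by_contra fun hne => hbelow i hi ⟨hwk, hne⟩) hx hx'
  refine ⟨x, hx.mono fun k hk => mem_of_le_entry hk.ge, hrel, ?_⟩
  refine (hbuchi.and_eventually (hrel.and (hx.and hx'))).mono ?_
  rintro k ⟨⟨hwk, hne⟩ | ⟨rfl, hck, hwk⟩, hrel, hx, hx'⟩ <;> rw [Function.comp_apply]
  · rw [hwk] at hrel ⊢
    refine UpTile.zero_mem_eps.2 ((UpTile.rel_eps.1 hrel).lt_of_ne fun heq => hne ?_)
    rw [hx, hx', heq]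
  · obtain ⟨t, ht⟩ := Option.ne_none_iff_exists'.1 hwk
    obtain ⟨hprio, hnext⟩ := some_mem_trans_addEps.1 (ht ▸ hq k)
    rw [ht]
    exact zero_mem_of_prio_eq (hprio.symm.trans hck) hx (hnext ▸ hx')

end EpsRuns

section Erasure

variable {Q : Type*} [LinearOrder Q] [Fintype Q] {B : OrderedBuchiAutomaton Q}

open Record

open Classical in
theorem mem_of_mem_epsRun {w' : ℕ → Option B.tiles} {w : ℕ → B.tiles} {g : ℕ → ℕ}
    {q s : ℕ → Record Q} {c : ℕ → ℤ} (hg : StrictMono g) (hgw : ∀ k, w' (g k) = some (w k))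
    (hrange : ∀ m, w' m ≠ none → m ∈ Set.range g)
    (hq : ∀ m, (q m, w' m, c m, q (m + 1)) ∈ (B.det.addEps (epsTransitions Q)).trans)
    (hs : ∀ k, s (k + 1) = (s k).next (w k)) (h0 : q 0 = s 0) (m : ℕ) :
    ∀ x ∈ (q m).toList, x ∈ (s (Nat.count (· ∈ Set.range g) m)).toList := by
  induction m with
  | zero => simp only [Nat.count_zero, h0, imp_self, implies_true]
  | succ m ih =>
    intro x hx
    by_cases hm : m ∈ Set.range g
    · obtain ⟨k, rfl⟩ := hm
      have hnext := (some_mem_trans_addEps.1 (hgw k ▸ hq (g k))).2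
      rw [hnext, mem_next] at hx
      obtain ⟨y, hy, hyx⟩ := hx
      have hy := ih y hy
      rw [Nat.count_succ, if_pos ⟨k, rfl⟩]
      rw [count_mem_range_of_strictMono hg] at hy ⊢
      exact hs k ▸ mem_next.2 ⟨y, hy, hyx⟩
    · have hnone : w' m = none := not_not.1 (mt (hrange m) hm)
      rw [Nat.count_succ, if_neg hm, add_zero]
      exact ih x (mem_of_mem_epsTransitions (none_mem_trans_addEps.1 (hnone ▸ hq m)) hx)

theorem epsLanguage_det_addEps_subset :
    (B.det.addEps (epsTransitions Q)).epsLanguage ⊆ B.det.language := by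
  classical
  rintro w ⟨w', ⟨q, c, h0, hq, hc⟩, g, hg, hgw, hrange⟩
  have hletters : ∃ᶠ m in atTop, w' m ≠ none :=
    hg.tendsto_atTop.frequently (.of_forall fun k => by simp [hgw])
  obtain ⟨x, hmem, hpath⟩ := exists_isBuchiPath_of_epsRun hq hletters hc
  let s : ℕ → Record Q := fun k => Nat.rec B.initRecord (fun k r => r.next (w k)) k
  have hs (k) : s (k + 1) = (s k).next (w k) := rfl
  have htile : (letterTile ∘ w') ∘ g = fun k => (w k).1 := by
    funext k
    simp [letterTile, hgw]
  have hpath' : IsBuchiPath (fun k => (w k).1) (x ∘ g) := htile ▸ hpath.comp_of_eps hg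
    fun m hm => by simp [letterTile, not_not.1 (mt (hrange m) hm)]
  have hmem' : ∀ᶠ k in atTop, (x ∘ g) k ∈ (s k).toList := by
    filter_upwards [hg.tendsto_atTop.eventually hmem] with k hk
    simpa only [count_mem_range_of_strictMono hg, Function.comp_apply]
      using mem_of_mem_epsRun hg hgw hrange hq hs h0 (g k) _ hk
  exact ⟨s, fun k => (s k).prio (w k), rfl, fun k => rfl,
    parityAccepting_prio_of_isBuchiPath hs hpath' hmem'⟩

end Erasure

namespace ParityAutomaton

variable {Letter State : Type*} {A : ParityAutomaton Letter State} {E : Set (State × ℤ × State)}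
  {X : Set State} {lo hi : ℤ} {d : ℕ}

theorem HasIndex.restrict (h : A.HasIndex lo hi) (X : Set State) :
    (A.restrict X).HasIndex lo hi :=
  fun _ _ _ _ => h _ _ _ _

theorem HasIndex.addEps (h : A.HasIndex lo hi) (hE : ∀ δ ∈ E, δ.2.1 ∈ Set.Icc lo hi) :
    (A.addEps E).HasIndex lo hi := by
  rintro _ _ _ _ (⟨_, -, hA⟩ | ⟨-, hmem⟩)
  exacts [h _ _ _ _ hA, hE _ hmem]

theorem HasIndex.normalize (h : A.HasIndex (-1) hi) (hhi : 1 ≤ hi) :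
    A.normalize.HasIndex 0 hi := by
  rintro q a _ q' ⟨c, hc, rfl⟩
  obtain ⟨h₁, h₂⟩ := h _ _ _ _ hc
  split_ifs <;> constructor <;> lia

theorem EpsPreorders.restrict {A : ParityAutomaton (Option Letter) State} (h : A.EpsPreorders d)
    (X : Set State) : (A.restrict X).EpsPreorders d where
  trans_odd i hi _ _ _ := h.trans_odd i hi _ _ _
  total_odd i hi _ _ := h.total_odd i hi _ _
  refines i hi _ _ := h.refines i hi _ _
  even_iff i hi _ _ := h.even_iff i hi _ _

theorem IsEpsComplete.restrict {A : ParityAutomaton (Option Letter) State}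
    (h : A.IsEpsComplete d) (X : Set State) : (A.restrict X).IsEpsComplete d :=
  ⟨h.1.restrict X, h.2.restrict X⟩

theorem epsLanguage_restrict_subset (A : ParityAutomaton (Option Letter) State) (X : Set State) :
    (A.restrict X).epsLanguage ⊆ A.epsLanguage :=
  fun _ ⟨w', ⟨q, c, h0, hq, hc⟩, hw⟩ => ⟨w', ⟨fun k => q k, c, h0, hq, hc⟩, hw⟩

theorem language_subset_epsLanguage_restrict (hX : ∀ q, A.Accessible q → q ∈ X) :
    A.language ⊆ ((A.addEps E).restrict X).epsLanguage := by
  rintro w ⟨q, c, h0, hq, hc⟩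
  have hacc (k) : A.Accessible (q k) := by
    induction k with
    | zero => exact .init _ h0
    | succ k ih => exact .step _ _ _ _ ih (hq k)
  exact ⟨fun k => some (w k), ⟨fun k => ⟨q k, hX _ (hacc k)⟩, c, h0,
    fun k => .inl ⟨w k, rfl, hq k⟩, hc⟩, id, strictMono_id, fun _ => rfl, fun m _ => ⟨m, rfl⟩⟩

theorem language_subset_epsLanguage_addEps : A.language ⊆ (A.addEps E).epsLanguage :=
  (language_subset_epsLanguage_restrict fun q _ => Set.mem_univ q).trans
    (epsLanguage_restrict_subset _ _)

theorem epsLanguage_restrict_eq (h : (A.addEps E).epsLanguage = A.language)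
    (hX : ∀ q, A.Accessible q → q ∈ X) :
    ((A.addEps E).restrict X).epsLanguage = A.language :=
  ((epsLanguage_restrict_subset _ X).trans_eq h).antisymm (language_subset_epsLanguage_restrict hX)

theorem Accessible.of_normalize {q : State} (h : A.normalize.Accessible q) : A.Accessible q := by
  induction h with
  | init q h => exact .init q h
  | step q a _ q' _ h ih =>
    obtain ⟨c, hc, -⟩ := h
    exact .step q a c q' ih hc

theorem language_subset_language_normalize (hA : A.HasIndex (-1) hi) :
    A.language ⊆ A.normalize.language := by
  rintro w ⟨q, c, h0, hq, hc⟩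
  refine ⟨q, fun k => if c k = -1 then 1 else c k, h0, fun k => ⟨c k, hq k, rfl⟩, hc.congr ?_⟩
  obtain ⟨m, hm, hle, heq⟩ := hc
  obtain ⟨k, rfl⟩ := heq.exists
  have hne : c k ≠ -1 := by
    rintro h
    exact absurd (h ▸ hm) (by decide)
  have := (hA _ _ _ _ (hq k)).1
  exact hle.mono fun l hl => (if_neg (by lia)).symm

end ParityAutomaton

section Completeness

variable {Q : Type*} [LinearOrder Q] [Fintype Q]

open ParityAutomaton Record

theorem epsPreorders_addEps_epsTransitions {Letter : Type*}
    (A : ParityAutomaton Letter (Record Q)) {d : ℕ} (hd : d < Fintype.card Q) :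
    (A.addEps (epsTransitions Q)).EpsPreorders d where
  trans_odd i _ p q r hpq hqr := by
    rw [EpsRel, none_mem_trans_addEps, odd_mem_epsTransitions] at *
    exact ⟨hpq.1, hqr.2.trans hpq.2⟩
  total_odd i hi p q := by
    simp only [EpsRel, none_mem_trans_addEps, odd_mem_epsTransitions, hi.trans_lt hd, true_and]
    exact le_total _ _
  refines i _ p q h := by
    rw [EpsRel, none_mem_trans_addEps] at *
    rw [← Nat.cast_add_one, odd_mem_epsTransitions] at h
    exact odd_mem_epsTransitions.2 ⟨i.lt_succ_self.trans h.1, pre_le_of_le h.2 i.le_succ⟩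
  even_iff i hi p q := by
    simp only [EpsRel, none_mem_trans_addEps, odd_mem_epsTransitions, even_mem_epsTransitions,
      hi.trans_lt hd, true_and]
    exact not_le.symm

theorem priority_mem_Icc_of_mem_epsTransitions (δ : Record Q × ℤ × Record Q)
    (hδ : δ ∈ epsTransitions Q) : δ.2.1 ∈ Set.Icc (0 : ℤ) (2 * Fintype.card Q - 1) := by
  obtain ⟨i, hi, h⟩ := mem_epsTransitions.1 hδ
  constructor <;> lia

theorem hasIndex_det (B : OrderedBuchiAutomaton Q) :
    B.det.HasIndex (-1) (2 * Fintype.card Q - 1) := by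
  intro s t c s' h
  obtain rfl : c = s.prio t := congrArg Prod.fst h
  exact prio_mem_Icc s t

end Completeness

section Normalization

variable {Q : Type*} [LinearOrder Q] [Fintype Q] {B : OrderedBuchiAutomaton Q}
  {s s' : Record Q} {o : Option B.tiles} {c : ℤ}

open ParityAutomaton Record

theorem some_mem_trans_normalize_addEps {t : B.tiles} :
    (s, some t, c, s') ∈ (B.det.normalize.addEps (epsTransitions Q)).trans ↔
      c = (if s.prio t = -1 then 1 else s.prio t) ∧ s' = s.next t := by
  constructor
  · rintro (⟨_, ⟨⟩, z, hz, hc⟩ | ⟨⟨⟩, -⟩)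
    obtain ⟨hprio, hs'⟩ : z = s.prio t ∧ s' = s.next t := Prod.ext_iff.1 hz
    exact ⟨hprio ▸ hc, hs'⟩
  · rintro ⟨hc, hs'⟩
    exact .inl ⟨t, rfl, s.prio t, Prod.ext rfl hs', hc⟩

theorem mem_trans_addEps_of_normalize
    (h : (s, o, c, s') ∈ (B.det.normalize.addEps (epsTransitions Q)).trans)
    (hne : ∃ a, a ∈ s'.toList) : (s, o, c, s') ∈ (B.det.addEps (epsTransitions Q)).trans := by
  cases o with
  | none => exact none_mem_trans_addEps.2 (none_mem_trans_addEps.1 h)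
  | some t =>
    obtain ⟨rfl, rfl⟩ := some_mem_trans_normalize_addEps.1 h
    obtain ⟨a, ha⟩ := hne
    refine some_mem_trans_addEps.2 ⟨if_neg fun h => ?_, rfl⟩
    exact List.ne_nil_of_mem ha (prio_eq_neg_one_iff.1 h)

theorem exists_mem_of_even_priority
    (h : (s, o, c, s') ∈ (B.det.normalize.addEps (epsTransitions Q)).trans) (hc : Even c) :
    ∃ a, a ∈ s.toList := by
  cases o with
  | none =>
    obtain ⟨l, rfl⟩ := hc
    obtain ⟨i, -, ⟨hlt, -⟩ | ⟨-, hodd⟩⟩ := mem_epsTransitions.1 (none_mem_trans_addEps.1 h)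
    · obtain ⟨j, -, hlt⟩ := exists_entry_lt_of_pre_lt hlt
      obtain ⟨a, ha⟩ := WithBot.ne_bot_iff_exists.1 hlt.ne_bot
      exact ⟨a, mem_of_le_entry ha.le⟩
    · lia
  | some t =>
    obtain ⟨rfl, rfl⟩ := some_mem_trans_normalize_addEps.1 h
    have hne : (s.next t).toList ≠ [] := fun h => by
      rw [if_pos (prio_eq_neg_one_iff.2 h)] at hc
      exact absurd hc (by decide)
    obtain ⟨b, hb⟩ := List.exists_mem_of_ne_nil _ hne
    exact (mem_next.1 hb).imp fun _ h => h.1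

theorem epsLanguage_normalize_addEps_subset :
    (B.det.normalize.addEps (epsTransitions Q)).epsLanguage ⊆
      (B.det.addEps (epsTransitions Q)).epsLanguage := by
  rintro w ⟨w', ⟨q, c, h0, hq, hc⟩, hw⟩
  have hne : ∀ k, ∃ a, a ∈ (q k).toList := by
    obtain ⟨m, hm, -, heq⟩ := hc
    exact forall_of_frequently_of_step_back
      (heq.mono fun k hk => exists_mem_of_even_priority (hq k) (hk ▸ hm))
      fun k h => exists_mem_of_mem_trans (mem_trans_addEps_of_normalize (hq k) h) h
  exact ⟨w', ⟨q, c, h0, fun k => mem_trans_addEps_of_normalize (hq k) (hne (k + 1)), hc⟩, hw⟩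

theorem epsLanguage_det_addEps :
    (B.det.addEps (epsTransitions Q)).epsLanguage = B.det.language :=
  epsLanguage_det_addEps_subset.antisymm language_subset_epsLanguage_addEps

theorem language_det_normalize : B.det.normalize.language = B.det.language :=
  (language_subset_epsLanguage_addEps.trans
    (epsLanguage_normalize_addEps_subset.trans epsLanguage_det_addEps_subset)).antisymm
    (language_subset_language_normalize (hasIndex_det B))

theorem epsLanguage_det_normalize_addEps :
    (B.det.normalize.addEps (epsTransitions Q)).epsLanguage = B.det.normalize.language :=
  ((epsLanguage_normalize_addEps_subset.trans epsLanguage_det_addEps_subset).trans_eq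
    language_det_normalize.symm).antisymm language_subset_epsLanguage_addEps

end Normalization

end OrderedBuchi

theorem mainTheorem9 {Q : Type*} [LinearOrder Q] [Fintype Q]
    (B : OrderedBuchi.OrderedBuchiAutomaton Q)
    (d : ℕ) (hd : Fintype.card Q = d + 1) :
    B.det.HasIndex (-1) (2 * d + 1) ∧
    (B.det.addEps (OrderedBuchi.epsTransitions Q)).EpsPreorders d ∧
    (B.det.addEps (OrderedBuchi.epsTransitions Q)).epsLanguage = B.det.language ∧
    (B.det.normalize.addEps (OrderedBuchi.epsTransitions Q)).IsEpsComplete d ∧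
    (B.det.normalize.addEps (OrderedBuchi.epsTransitions Q)).epsLanguage = B.det.language ∧
    ∀ X : Set (OrderedBuchi.Record Q), (∀ s, B.det.Accessible s → s ∈ X) →
      ((B.det.addEps (OrderedBuchi.epsTransitions Q)).restrict X).EpsPreorders d ∧
      ((B.det.addEps (OrderedBuchi.epsTransitions Q)).restrict X).epsLanguage = B.det.language ∧
      ((B.det.normalize.addEps (OrderedBuchi.epsTransitions Q)).restrict X).IsEpsComplete d ∧
      ((B.det.normalize.addEps (OrderedBuchi.epsTransitions Q)).restrict X).epsLanguage =
        B.det.language := by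
  have hcard : (2 * Fintype.card Q - 1 : ℤ) = 2 * d + 1 := by lia
  have hdet : B.det.HasIndex (-1) (2 * d + 1) := hcard ▸ OrderedBuchi.hasIndex_det B
  have hpreorders (A : OrderedBuchi.ParityAutomaton B.tiles (OrderedBuchi.Record Q)) :
      (A.addEps (OrderedBuchi.epsTransitions Q)).EpsPreorders d :=
    OrderedBuchi.epsPreorders_addEps_epsTransitions A (by lia)
  have hcomplete : (B.det.normalize.addEps (OrderedBuchi.epsTransitions Q)).IsEpsComplete d :=
    ⟨(hdet.normalize (by lia)).addEps
      (hcard ▸ OrderedBuchi.priority_mem_Icc_of_mem_epsTransitions), hpreorders _⟩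
  refine ⟨hdet, hpreorders _, OrderedBuchi.epsLanguage_det_addEps, hcomplete,
    OrderedBuchi.epsLanguage_det_normalize_addEps.trans OrderedBuchi.language_det_normalize,
    fun X hX => ⟨(hpreorders _).restrict X, ?_, hcomplete.restrict X, ?_⟩⟩
  · exact OrderedBuchi.ParityAutomaton.epsLanguage_restrict_eq
      OrderedBuchi.epsLanguage_det_addEps hX
  · exact (OrderedBuchi.ParityAutomaton.epsLanguage_restrict_eq
      OrderedBuchi.epsLanguage_det_normalize_addEps fun s hs => hX s hs.of_normalize).trans
      OrderedBuchi.language_det_normalize
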